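/- Let $K$ be a field of characteristic zero, let $X^*$ be the set of words over the alphabet $\{x_0,x_1\}$ (the empty word is written $1$), and let $K\langle\langle X\rangle\rangle$ be the space of noncommutative formal power series $c=\sum_{\eta\in X^*}c(\eta)\,\eta$ with the shuffle product $\sqcup\!\sqcup$ (dual to the coproduct on words that is multiplicative for concatenation and has $x_i\mapsto x_i\otimes 1+1\otimes x_i$), whose unit is the series $\emptyset$ of the empty word. For $\mathbf d=(d_1,d_2)\in K\langle\langle X\rangle\rangle^2$ the mixed composition product $c\,\tilde\circ\,\mathbf d=\sum_{\eta}c(\eta)\,(\eta\,\tilde\circ\,\mathbf d)$ is given on words by $$1\,\tilde\circ\,\mathbf d=\emptyset,\qquad x_0\eta\,\tilde\circ\,\mathbf d=x_0(\eta\,\tilde\circ\,\mathbf d),\qquad x_1\eta\,\tilde\circ\,\mathbf d=x_1\bigl(d_1\mathbin{\sqcup\!\sqcup}(\eta\,\tilde\circ\,\mathbf d)\bigr)+x_0\bigl(d_2\mathbin{\sqcup\!\sqcup}(\eta\,\tilde\circ\,\mathbf d)\bigr).$$ On the set $G=\{\mathbf c=(c_1,c_2)\in K\langle\langle X\rangle\rangle^2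 : c_1(1)=1\}$ put $$\mathbf c\cdot\mathbf d=(c_1\mathbin{\sqcup\!\sqcup}d_1,\;c_2+c_1\mathbin{\sqcup\!\sqcup}d_2),\qquad \mathbf c\triangleleft\mathbf d=(c_1\,\tilde\circ\,\mathbf d,\;c_2\,\tilde\circ\,\mathbf d),\qquad \mathbf c\star\mathbf d=(\mathbf c\triangleleft\mathbf d)\cdot\mathbf d .$$ Let $\mathcal H$ be the algebra of coordinate functions on $G$, i.e. the polynomial algebra over $K$ in the symbols $\eta\epsilon_i$ ($\eta\in X^*$, $i=1,2$) modulo the relation $1\epsilon_1=\mathbf 1$, where $(\eta\epsilon_i)(\mathbf c)=c_i(\eta)$. Let $\mu$ be its product and let $\varepsilon:\mathcal H\to K$ be the algebra morphism that vanishes on all $\eta\epsilon_i$ other than $1\epsilon_1$. Then there are unique algebra morphisms $\delta,\rho,\Delta:\mathcal H\to\mathcal H\otimes\mathcal H$ such that for all $\eta\in X^*$, $i\in\{1,2\}$ and $\mathbf c,\mathbf d\in G$ $$\delta(\eta\epsilon_i)(\mathbf c\otimes\mathbf d)=(\mathbf c\cdot\mathbf d)_i(\eta),\qquad \rho(\eta\epsilon_i)(\mathbf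 c\otimes\mathbf d)=(\mathbf c\triangleleft\mathbf d)_i(\eta),\qquad \Delta(\eta\epsilon_i)(\mathbf c\otimes\mathbf d)=(\mathbf c\star\mathbf d)_i(\eta),$$ and they satisfy the following. 1. $\Delta=(\mathrm{id}\otimes\mu)\circ(\rho\otimes\mathrm{id})\circ\delta$. 2. $(\mathcal H,\mu,\Delta,\varepsilon)$ is a Hopf algebra. 3. $(\mathcal H,\mu,\delta,\varepsilon)$ is a Hopf algebra in the category of right $(\mathcal H,\mu,\Delta,\varepsilon)$-comodules via $\rho$. That is, it is a Hopf algebra, $\rho$ is a right coaction of $(\mathcal H,\Delta,\varepsilon)$ on $\mathcal H$, and the product, the unit, the coproduct $\delta$, the counit $\varepsilon$ and the antipode are morphisms of right $(\mathcal H,\Delta)$-comodules, where $\mathcal H\otimes\mathcal H$ carries the coaction $a\otimes b\mapsto (a_0\otimes b_0)\otimes a_1b_1$ (with $\rho(a)=a_0\otimes a_1$) and $K$ carries the coaction $k\mapsto k\otimes\mathbf 1$. -/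

import Mathlib

open scoped TensorProduct

namespace AffineFeedback

/-! ## Words, formal power series, shuffle product -/

section Series

variable {K : Type*} [Field K]

/-- Words over the alphabet `{x₀, x₁}`; the letter `i : Fin 2` is `xᵢ`, and `[]` is the empty
word. -/
abbrev Word : Type := List (Fin 2)

/-- Noncommutative formal power series, given by their coefficients `c(η)`. -/
abbrev Series (K : Type*) : Type _ := Word → K

/-- The terms of the unshuffle coproduct of a word: the coproduct is the multiplicative map with
`xᵢ ↦ xᵢ ⊗ 1 + 1 ⊗ xᵢ`, so that the coproduct of `xᵢ η` is `(xᵢ ⊗ 1 + 1 ⊗ xᵢ)` times the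
coproduct of `η`. -/
def unshuffle : Word → List (Word × Word)
  | [] => [([], [])]
  | a :: w =>
      (unshuffle w).map (fun p => (a :: p.1, p.2)) ++ (unshuffle w).map (fun p => (p.1, a :: p.2))

/-- The shuffle product of series: convolution with respect to the unshuffle coproduct. -/
def shuffle (c d : Series K) : Series K :=
  fun w => ((unshuffle w).map fun p => c p.1 * d p.2).sum

/-- The series of the empty word, the unit of the shuffle product. -/
def emptySeries : Series K := fun w => if w = [] then 1 else 0

/-- Left concatenation with a letter, `c ↦ xₐ c`. -/
def prepend (a : Fin 2) (c : Series K) : Series K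
  | [] => 0
  | b :: w => if b = a then c w else 0

/-- Pairs `𝐜 = [c₁ c₂]` of series; `c 0` is the multiplicative component `c₁`, and `c 1` is the
additive component `c₂`. -/
abbrev SeriesPair (K : Type*) : Type _ := Fin 2 → Series K

/-- The mixed composition of a word with a pair of series. -/
def wordMixComp (d : SeriesPair K) : Word → Series K
  | [] => emptySeries
  | a :: η =>
      if a = 0 then prepend 0 (wordMixComp d η)
      else prepend 1 (shuffle (d 0) (wordMixComp d η)) +
        prepend 0 (shuffle (d 1) (wordMixComp d η))

/-- The mixed composition product, the sum of `c(η)` times the mixed composition of `η` with `d`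
over all words `η`. Each coefficient is a finite sum, see `finite_support_mixComp`. -/
noncomputable def mixComp (c : Series K) (d : SeriesPair K) : Series K :=
  fun w => ∑ᶠ η : Word, c η * wordMixComp d η w

theorem length_le_of_mem_unshuffle {w : Word} {p : Word × Word} (hp : p ∈ unshuffle w) :
    p.2.length ≤ w.length := by
  induction w generalizing p with
  | nil => simp [unshuffle] at hp; simp [hp]
  | cons a w ih =>
    simp only [unshuffle, List.mem_append, List.mem_map] at hp
    rcases hp with ⟨q, hq, rfl⟩ | ⟨q, hq, rfl⟩
    · exact (ih hq).trans (by simp)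
    · simpa using ih hq

theorem shuffle_eq_zero {c d : Series K} {n : ℕ} (hd : ∀ v : Word, v.length < n → d v = 0)
    {w : Word} (hw : w.length < n) : shuffle c d w = 0 := by
  apply List.sum_eq_zero
  intro x hx
  obtain ⟨p, hp, rfl⟩ := List.mem_map.1 hx
  rw [hd _ ((length_le_of_mem_unshuffle hp).trans_lt hw), mul_zero]

theorem prepend_eq_zero {a : Fin 2} {d : Series K} {n : ℕ}
    (hd : ∀ v : Word, v.length < n → d v = 0) {w : Word} (hw : w.length < n + 1) :
    prepend a d w = 0 := by
  cases w with
  | nil => rfl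
  | cons b w =>
    simp only [prepend]
    split_ifs
    · exact hd _ (by simpa using hw)
    · rfl

theorem wordMixComp_eq_zero (d : SeriesPair K) (η : Word) :
    ∀ w : Word, w.length < η.length → wordMixComp d η w = 0 := by
  induction η with
  | nil => simp
  | cons a η ih =>
    intro w hw
    simp only [wordMixComp]
    split_ifs
    · exact prepend_eq_zero ih hw
    · rw [Pi.add_apply, prepend_eq_zero (fun v hv => shuffle_eq_zero ih hv) hw,
        prepend_eq_zero (fun v hv => shuffle_eq_zero ih hv) hw, add_zero]

theorem finite_support_mixComp (c : Series K) (d : SeriesPair K) (w : Word) :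
    (Function.support fun η : Word => c η * wordMixComp d η w).Finite := by
  refine (List.finite_length_le (Fin 2) w.length).subset fun η hη => ?_
  by_contra h
  exact hη (by simp [wordMixComp_eq_zero d η w (not_le.1 h)])

theorem mixComp_nil (c : Series K) (d : SeriesPair K) : mixComp c d [] = c [] := by
  unfold mixComp
  rw [finsum_eq_single _ ([] : Word)]
  · simp [wordMixComp, emptySeries]
  · intro η hη
    rw [wordMixComp_eq_zero d η [] (by simpa using List.length_pos_iff.2 hη), mul_zero]

end Series

/-! ## The set `G`, the product `·`, the action `◁` and the product `⋆` -/

section Group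

variable {K : Type*} [Field K]

/-- The set `G` of pairs of series `𝐜` with `c₁(1) = 1`. -/
abbrev G (K : Type*) [Field K] : Type _ := {c : SeriesPair K // c 0 [] = 1}

/-- `𝐜 · 𝐝 = [c₁ ⧢ d₁, c₂ + c₁ ⧢ d₂]`. -/
def G.dot (c d : G K) : G K :=
  ⟨![shuffle (c.1 0) (d.1 0), c.1 1 + shuffle (c.1 0) (d.1 1)], by
    simp [shuffle, unshuffle, c.2, d.2]⟩

/-- `𝐜 ◁ 𝐝`, the mixed composition product in each component. -/
noncomputable def G.act (c d : G K) : G K :=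
  ⟨fun i => mixComp (c.1 i) d.1, (mixComp_nil _ _).trans c.2⟩

/-- The Grossman–Larson product `𝐜 ⋆ 𝐝 = (𝐜 ◁ 𝐝) · 𝐝`, that is, the affine feedback product. -/
noncomputable def G.star (c d : G K) : G K := G.dot (G.act c d) d

end Group

/-! ## The algebra of coordinate functions on `G` -/

section Coordinates

/-- The algebra `H`: the polynomial algebra on the symbols `η ε₁`, `η ε₂` (`η` a word; the symbols
are the pairs `(η, 0)`, `(η, 1)`), modulo the relation `1 ε₁ = 𝟏`. -/
def H (K : Type*) [Field K] : Type _ :=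
  MvPolynomial (Word × Fin 2) K ⧸
    Ideal.span {(MvPolynomial.X (([] : Word), (0 : Fin 2)) - 1 : MvPolynomial (Word × Fin 2) K)}

variable (K : Type*) [Field K]

noncomputable instance : CommRing (H K) :=
  inferInstanceAs (CommRing (MvPolynomial (Word × Fin 2) K ⧸
    Ideal.span {(MvPolynomial.X (([] : Word), (0 : Fin 2)) - 1 : MvPolynomial (Word × Fin 2) K)}))

noncomputable instance : Algebra K (H K) :=
  inferInstanceAs (Algebra K (MvPolynomial (Word × Fin 2) K ⧸
    Ideal.span {(MvPolynomial.X (([] : Word), (0 : Fin 2)) - 1 : MvPolynomial (Word × Fin 2) K)}))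

/-- The coordinate function `η ε₁` (for `i = 0`) or `η ε₂` (for `i = 1`). -/
noncomputable def coord (η : Word) (i : Fin 2) : H K :=
  Ideal.Quotient.mk _ (MvPolynomial.X (η, i))

variable {K}

/-- The algebra morphism on `H` that takes prescribed values on the coordinate functions. -/
noncomputable def liftH (v : Word → Fin 2 → K) (hv : v [] 0 = 1) : H K →ₐ[K] K :=
  Ideal.Quotient.liftₐ _ (MvPolynomial.aeval fun p : Word × Fin 2 => v p.1 p.2) <| by
    intro a ha
    rw [← RingHom.mem_ker]
    refine (Ideal.span_le.2 ?_ : Ideal.span _ ≤ RingHom.ker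
      (MvPolynomial.aeval fun p : Word × Fin 2 => v p.1 p.2 :
        MvPolynomial (Word × Fin 2) K →ₐ[K] K)) ha
    rw [Set.singleton_subset_iff, SetLike.mem_coe, RingHom.mem_ker]
    simp [hv]

/-- Evaluation of functions at a point of `G`: `η εᵢ ↦ cᵢ(η)`. -/
noncomputable def evalAt (c : G K) : H K →ₐ[K] K := liftH (fun η i => c.1 i η) c.2

/-- Evaluation of an element of `H ⊗ H` at a pair of points of `G`. -/
noncomputable def evalAt₂ (c d : G K) : H K ⊗[K] H K →ₐ[K] K :=
  Algebra.TensorProduct.lift (evalAt c) (evalAt d) fun _ _ => Commute.all _ _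

/-- An algebra morphism `φ : H → H ⊗ H` dualizes a binary operation `op` on `G` if
`φ(η εᵢ)(𝐜 ⊗ 𝐝) = (op 𝐜 𝐝)ᵢ(η)`. -/
def Dualizes (φ : H K →ₐ[K] H K ⊗[K] H K) (op : G K → G K → G K) : Prop :=
  ∀ (η : Word) (i : Fin 2) (c d : G K), evalAt₂ c d (φ (coord K η i)) = (op c d).1 i η

variable (K) in
/-- The counit of `H`: the algebra morphism that kills all coordinate functions other than
`1 ε₁ = 𝟏`. -/
noncomputable def counitH : H K →ₐ[K] K :=
  liftH (fun η i => if η = [] ∧ i = 0 then 1 else 0) (by simp)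

end Coordinates

/-! ## Hopf algebras, comodules, and Hopf algebras in a category of comodules -/

section Hopf

variable {K : Type*} [Field K]

/-- The algebra morphisms `Δ` (coproduct) and `ε` (counit) make the algebra `A` a bialgebra. -/
structure IsBialgebra {A : Type*} [CommRing A] [Algebra K A]
    (Δ : A →ₐ[K] A ⊗[K] A) (ε : A →ₐ[K] K) : Prop where
  coassoc : (TensorProduct.assoc K A A A).toLinearMap ∘ₗ Δ.toLinearMap.rTensor A ∘ₗ Δ.toLinearMap =
    Δ.toLinearMap.lTensor A ∘ₗ Δ.toLinearMap
  counit_left : (TensorProduct.lid K A).toLinearMap ∘ₗ ε.toLinearMap.rTensor A ∘ₗ Δ.toLinearMap =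
    LinearMap.id
  counit_right : (TensorProduct.rid K A).toLinearMap ∘ₗ ε.toLinearMap.lTensor A ∘ₗ Δ.toLinearMap =
    LinearMap.id

/-- `S` is an antipode for the coproduct `Δ` and the counit `ε`. -/
structure IsAntipode {A : Type*} [CommRing A] [Algebra K A]
    (Δ : A →ₐ[K] A ⊗[K] A) (ε : A →ₐ[K] K) (S : A →ₗ[K] A) : Prop where
  left : LinearMap.mul' K A ∘ₗ S.rTensor A ∘ₗ Δ.toLinearMap =
    Algebra.linearMap K A ∘ₗ ε.toLinearMap
  right : LinearMap.mul' K A ∘ₗ S.lTensor A ∘ₗ Δ.toLinearMap =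
    Algebra.linearMap K A ∘ₗ ε.toLinearMap

/-- `(A, Δ, ε)` is a Hopf algebra. -/
def IsHopfAlgebra {A : Type*} [CommRing A] [Algebra K A]
    (Δ : A →ₐ[K] A ⊗[K] A) (ε : A →ₐ[K] K) : Prop :=
  IsBialgebra Δ ε ∧ ∃ S : A →ₗ[K] A, IsAntipode Δ ε S

variable {B : Type*} [CommRing B] [Algebra K B]
variable {M N : Type*} [AddCommGroup M] [Module K M] [AddCommGroup N] [Module K N]

/-- `ρ` is a right coaction of the coalgebra `(B, Δ, ε)` on `M`. -/
structure IsRightCoaction (Δ : B →ₐ[K] B ⊗[K] B) (ε : B →ₐ[K] K) (ρ : M →ₗ[K] M ⊗[K] B) :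
    Prop where
  coassoc : (TensorProduct.assoc K M B B).toLinearMap ∘ₗ ρ.rTensor B ∘ₗ ρ =
    Δ.toLinearMap.lTensor M ∘ₗ ρ
  counit : (TensorProduct.rid K M).toLinearMap ∘ₗ ε.toLinearMap.lTensor M ∘ₗ ρ = LinearMap.id

/-- `f` is a morphism of right comodules from `(M, ρM)` to `(N, ρN)`. -/
def IsComoduleHom (ρM : M →ₗ[K] M ⊗[K] B) (ρN : N →ₗ[K] N ⊗[K] B) (f : M →ₗ[K] N) : Prop :=
  ρN ∘ₗ f = f.rTensor B ∘ₗ ρM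

/-- The coaction on the tensor product of two right comodules over a bialgebra `B`,
`m ⊗ n ↦ (m₀ ⊗ n₀) ⊗ m₁ n₁`. -/
noncomputable def tensorCoaction (ρM : M →ₗ[K] M ⊗[K] B) (ρN : N →ₗ[K] N ⊗[K] B) :
    M ⊗[K] N →ₗ[K] (M ⊗[K] N) ⊗[K] B :=
  (LinearMap.mul' K B).lTensor (M ⊗[K] N) ∘ₗ
    (TensorProduct.tensorTensorTensorComm K M B N B).toLinearMap ∘ₗ TensorProduct.map ρM ρN

variable (K B) in
/-- The coaction `k ↦ k ⊗ 1` on the unit comodule `K`. -/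
noncomputable def unitCoaction : K →ₗ[K] K ⊗[K] B := (TensorProduct.mk K K B).flip 1

/-- `(A, δ, ε)` is a Hopf algebra in the (symmetric monoidal) category of right comodules over the
commutative bialgebra `(B, Δ, εB)` via `ρ`: it is a Hopf algebra, `ρ` is a right coaction, and
product, unit, coproduct, counit and antipode are morphisms of comodules. -/
def IsHopfAlgebraInComodules {A : Type*} [CommRing A] [Algebra K A]
    (Δ : B →ₐ[K] B ⊗[K] B) (εB : B →ₐ[K] K)
    (δ : A →ₐ[K] A ⊗[K] A) (ε : A →ₐ[K] K) (ρ : A →ₗ[K] A ⊗[K] B) : Prop :=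
  IsRightCoaction Δ εB ρ ∧
  IsComoduleHom (tensorCoaction ρ ρ) ρ (LinearMap.mul' K A) ∧
  IsComoduleHom (unitCoaction K B) ρ (Algebra.linearMap K A) ∧
  IsBialgebra δ ε ∧
  IsComoduleHom ρ (tensorCoaction ρ ρ) δ.toLinearMap ∧
  IsComoduleHom ρ (unitCoaction K B) ε.toLinearMap ∧
  ∃ S : A →ₗ[K] A, IsAntipode δ ε S ∧ IsComoduleHom ρ ρ S

end Hopf

end AffineFeedback

/-! Everything is checked on points. Since `K` is infinite, an element of `H K` is determined by its
values on `G K` (`separates_evalAt`), and this passes to tensor products (`Separates.tensor`). Each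
Hopf or comodule axiom then becomes an identity on `G`: `G.dot` and `G.star` are group laws, and
`G.act` is a right action of the second group on the first by group endomorphisms. These identities
rest on two facts: composition with a fixed pair is a morphism for the shuffle product
(`mixComp_shuffle`), and composing with `d` and then `e` is composing with the star product of `d`
and `e` (`mixComp_mixComp`). Both follow by induction on word length, because left derivatives
determine a series up to its constant term and obey a Leibniz rule for shuffles and a chain rule for
compositions. The algebra morphisms exist because the coefficients of the operations are polynomial
in those of the arguments. For the antipodes, `d ↦ op c d` is triangular with leading coefficient 1
with respect to word length, so a right inverse is a limit of iterates that stabilises in each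
degree and has polynomial coordinates. -/

namespace AffineFeedback

/-! ### The shuffle algebra, through left derivatives. -/

section Shuffle

variable {K : Type*} [Field K]

/-- The left derivative of a series by a letter. -/
def shift {K : Type*} (a : Fin 2) (c : Series K) : Series K := fun w => c (a :: w)

theorem shift_apply {K : Type*} (a : Fin 2) (c : Series K) (w : Word) : shift a c w = c (a :: w) :=
  rfl

theorem apply_cons_congr {K : Type*} {c d : Series K} {a : Fin 2} {w : Word}
    (h : shift a c w = shift a d w) : c (a :: w) = d (a :: w) := h

theorem shift_add (a : Fin 2) (c d : Series K) : shift a (c + d) = shift a c + shift a d := rfl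

theorem shift_smul (a : Fin 2) (k : K) (c : Series K) : shift a (k • c) = k • shift a c := rfl

theorem shift_emptySeries (a : Fin 2) : shift a (emptySeries : Series K) = 0 := by
  ext w
  simp [shift, emptySeries]

theorem shuffle_nil (c d : Series K) : shuffle c d [] = c [] * d [] := by
  simp [shuffle, unshuffle]

theorem shuffle_cons (c d : Series K) (a : Fin 2) (w : Word) :
    shuffle c d (a :: w) = shuffle (shift a c) d w + shuffle c (shift a d) w := by
  simp [shuffle, unshuffle, Function.comp_def, shift]

theorem shift_shuffle (a : Fin 2) (c d : Series K) :
    shift a (shuffle c d) = shuffle (shift a c) d + shuffle c (shift a d) :=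
  funext fun w => shuffle_cons c d a w

theorem shuffle_comm (c d : Series K) : shuffle c d = shuffle d c := by
  ext w
  induction w generalizing c d with
  | nil => simp only [shuffle_nil, mul_comm]
  | cons a w ih => rw [shuffle_cons, shuffle_cons, ih, ih c, add_comm]

theorem shuffle_add (c d e : Series K) : shuffle c (d + e) = shuffle c d + shuffle c e := by
  ext w
  induction w generalizing c d e with
  | nil => simp only [shuffle_nil, Pi.add_apply, mul_add]
  | cons a w ih =>
    simp only [Pi.add_apply, shuffle_cons, shift_add, ih]
    ring

theorem add_shuffle (c d e : Series K) : shuffle (c + d) e = shuffle c e + shuffle d e := by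
  rw [shuffle_comm, shuffle_add, shuffle_comm e, shuffle_comm e]

theorem shuffle_smul (k : K) (c d : Series K) : shuffle c (k • d) = k • shuffle c d := by
  ext w
  induction w generalizing c d with
  | nil => simp only [shuffle_nil, Pi.smul_apply, smul_eq_mul]; ring
  | cons a w ih =>
    simp only [Pi.smul_apply, shuffle_cons, shift_smul, ih, smul_add]

/-- Shuffling with a fixed series, as a linear map. -/
def shuffleLin (c : Series K) : Series K →ₗ[K] Series K where
  toFun := shuffle c
  map_add' := shuffle_add c
  map_smul' k := shuffle_smul k c

theorem shuffle_zero (c : Series K) : shuffle c 0 = 0 := map_zero (shuffleLin c)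

theorem shuffle_sub (c d e : Series K) : shuffle c (d - e) = shuffle c d - shuffle c e :=
  map_sub (shuffleLin c) d e

theorem shuffle_sum {ι : Type*} (s : Finset ι) (c : Series K) (f : ι → Series K) :
    shuffle c (∑ i ∈ s, f i) = ∑ i ∈ s, shuffle c (f i) :=
  map_sum (shuffleLin c) f s

theorem shuffle_emptySeries (c : Series K) : shuffle c emptySeries = c := by
  ext w
  induction w generalizing c with
  | nil => simp [shuffle_nil, emptySeries]
  | cons a w ih =>
    rw [shuffle_cons, ih, shift_emptySeries, shuffle_zero, Pi.zero_apply, add_zero, shift_apply]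

theorem emptySeries_shuffle (c : Series K) : shuffle emptySeries c = c := by
  rw [shuffle_comm, shuffle_emptySeries]

theorem shuffle_assoc (c d e : Series K) :
    shuffle (shuffle c d) e = shuffle c (shuffle d e) := by
  ext w
  induction w generalizing c d e with
  | nil => simp only [shuffle_nil, mul_assoc]
  | cons a w ih =>
    simp only [shuffle_cons, shift_shuffle, add_shuffle, shuffle_add, Pi.add_apply, ih]
    ring

instance : Std.Commutative (shuffle : Series K → Series K → Series K) := ⟨shuffle_comm⟩

instance : Std.Associative (shuffle : Series K → Series K → Series K) := ⟨shuffle_assoc⟩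

theorem shuffle_congr {c c' d d' : Series K} {n : ℕ}
    (hc : ∀ v : Word, v.length < n → c v = c' v) (hd : ∀ v : Word, v.length < n → d v = d' v)
    {w : Word} (hw : w.length < n) : shuffle c d w = shuffle c' d' w := by
  have key : ∀ {c d d' : Series K}, (∀ v : Word, v.length < n → d v = d' v) →
      shuffle c d w = shuffle c d' w := fun h => by
    unfold shuffle
    congr 1
    exact List.map_congr_left fun p hp => by
      rw [h _ ((length_le_of_mem_unshuffle hp).trans_lt hw)]
  rw [key hd, shuffle_comm, key hc, shuffle_comm]

/-- Only the term `([], w)` of the unshuffle coproduct leaves a second factor as long as `w`; all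
others see `d` where it vanishes. -/
theorem shuffle_of_eq_zero {c d : Series K} {w : Word}
    (hd : ∀ v : Word, v.length < w.length → d v = 0) : shuffle c d w = c [] * d w := by
  induction w generalizing d with
  | nil => exact shuffle_nil c d
  | cons a w ih =>
    rw [shuffle_cons, shuffle_eq_zero hd (Nat.lt_succ_self _), zero_add,
      ih (d := shift a d) fun v hv => hd (a :: v) (Nat.succ_lt_succ hv), shift_apply]

/-- The source of triangularity: up to the length of `w` the first factors are interchangeable, and
`c'` acts on `d - d'` only through its constant term 1. -/
theorem shuffle_sub_shuffle {c c' d d' : Series K} {w : Word} (h : c' [] = 1)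
    (hc : ∀ v : Word, v.length ≤ w.length → c v = c' v)
    (hd : ∀ v : Word, v.length < w.length → d v = d' v) :
    shuffle c d w - shuffle c' d' w = d w - d' w := by
  rw [shuffle_congr (fun v hv => hc v (Nat.lt_succ_iff.1 hv)) (fun _ _ => rfl)
    (Nat.lt_succ_self w.length), ← Pi.sub_apply, ← shuffle_sub, shuffle_of_eq_zero, h, one_mul,
    Pi.sub_apply]
  intro v hv
  rw [Pi.sub_apply, hd v hv, sub_self]

end Shuffle

/-! ### The mixed composition product and its chain rule. -/

section MixComp

variable {K : Type*} [Field K]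

/-- The words of length at most `n`. -/
def words : ℕ → Finset Word
  | 0 => {[]}
  | n + 1 => insert [] ((words n).image (List.cons 0) ∪ (words n).image (List.cons 1))

theorem mem_words {n : ℕ} {w : Word} : w ∈ words n ↔ w.length ≤ n := by
  induction n generalizing w with
  | zero => simp [words]
  | succ n ih =>
    cases w with
    | nil => simp [words]
    | cons a w => fin_cases a <;> simp [words, ih]

theorem sum_words_succ {M : Type*} [AddCommMonoid M] (n : ℕ) (f : Word → M) :
    ∑ η ∈ words (n + 1), f η =
      f [] + (∑ η ∈ words n, f (0 :: η) + ∑ η ∈ words n, f (1 :: η)) := by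
  have hdis : Disjoint ((words n).image (List.cons (0 : Fin 2)))
      ((words n).image (List.cons (1 : Fin 2))) := by
    simp [Finset.disjoint_left]
  rw [words, Finset.sum_insert (by simp), Finset.sum_union hdis,
    Finset.sum_image (List.cons_injective.injOn), Finset.sum_image (List.cons_injective.injOn)]

/-- The partial sums of the mixed composition product. -/
def partialMixComp (n : ℕ) (c : Series K) (d : SeriesPair K) : Series K :=
  ∑ η ∈ words n, c η • wordMixComp d η

/-- Words longer than `w` contribute nothing at `w`. This trades the infinite sum for a finite one,
through which shuffling with a series can be moved. -/
theorem mixComp_eq_partialMixComp {n : ℕ} (c : Series K) (d : SeriesPair K) {w : Word}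
    (hw : w.length ≤ n) : mixComp c d w = partialMixComp n c d w := by
  unfold mixComp partialMixComp
  rw [finsum_eq_sum_of_support_subset (s := words n), Finset.sum_apply]
  · rfl
  · intro η hη
    rw [Finset.mem_coe, mem_words]
    by_contra h
    exact hη (by simp [wordMixComp_eq_zero d η w (by omega)])

theorem prepend_cons (a b : Fin 2) (c : Series K) (w : Word) :
    prepend a c (b :: w) = if b = a then c w else 0 := rfl

theorem shuffle_partialMixComp (n : ℕ) (c e : Series K) (d : SeriesPair K) :
    shuffle e (partialMixComp n c d) = ∑ η ∈ words n, c η • shuffle e (wordMixComp d η) := by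
  simp only [partialMixComp, shuffle_sum, shuffle_smul]

/-- An output word beginning with `x₀` comes from `x₀η` or from the `x₀` part of `x₁η`. With
`shift_one_mixComp` and `mixComp_nil` this determines the composition recursively. -/
theorem shift_zero_mixComp (c : Series K) (d : SeriesPair K) :
    shift 0 (mixComp c d) =
      mixComp (shift 0 c) d + shuffle (d 1) (mixComp (shift 1 c) d) := by
  ext w
  rw [shift_apply, mixComp_eq_partialMixComp c d (Nat.le_refl _), List.length_cons,
    Pi.add_apply, mixComp_eq_partialMixComp _ d (Nat.le_refl _),
    shuffle_congr (fun _ _ => rfl)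
      (fun v hv => mixComp_eq_partialMixComp _ d (Nat.lt_succ_iff.1 hv))
      (Nat.lt_succ_self w.length), shuffle_partialMixComp]
  simp [partialMixComp, sum_words_succ, wordMixComp, prepend_cons, Finset.sum_apply, emptySeries,
    shift_apply]

theorem shift_one_mixComp (c : Series K) (d : SeriesPair K) :
    shift 1 (mixComp c d) = shuffle (d 0) (mixComp (shift 1 c) d) := by
  ext w
  rw [shift_apply, mixComp_eq_partialMixComp c d (Nat.le_refl _), List.length_cons,
    shuffle_congr (fun _ _ => rfl)
      (fun v hv => mixComp_eq_partialMixComp _ d (Nat.lt_succ_iff.1 hv))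
      (Nat.lt_succ_self w.length), shuffle_partialMixComp]
  simp [partialMixComp, sum_words_succ, wordMixComp, prepend_cons, Finset.sum_apply, emptySeries,
    shift_apply]

theorem mixComp_add (c c' : Series K) (d : SeriesPair K) :
    mixComp (c + c') d = mixComp c d + mixComp c' d := by
  ext w
  simp only [Pi.add_apply, mixComp_eq_partialMixComp _ d (Nat.le_refl w.length), partialMixComp,
    add_smul, Finset.sum_add_distrib]

theorem mixComp_zero (d : SeriesPair K) : mixComp (0 : Series K) d = 0 := by
  ext w
  simp [mixComp]

theorem mixComp_emptySeries (d : SeriesPair K) :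
    mixComp (emptySeries : Series K) d = emptySeries := by
  ext w
  match w with
  | [] => exact mixComp_nil _ _
  | 0 :: w =>
    refine apply_cons_congr ?_
    rw [shift_zero_mixComp]
    simp [shift_emptySeries, mixComp_zero, shuffle_zero]
  | 1 :: w =>
    refine apply_cons_congr ?_
    rw [shift_one_mixComp]
    simp [shift_emptySeries, mixComp_zero, shuffle_zero]

/-- The Leibniz rule makes both sides satisfy the same recursion under left derivatives. -/
theorem mixComp_shuffle (c c' : Series K) (d : SeriesPair K) :
    mixComp (shuffle c c') d = shuffle (mixComp c d) (mixComp c' d) := by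
  suffices h : ∀ (n : ℕ) (c c' : Series K) (w : Word), w.length < n →
      mixComp (shuffle c c') d w = shuffle (mixComp c d) (mixComp c' d) w from
    funext fun w => h _ c c' w (Nat.lt_succ_self _)
  intro n
  induction n with
  | zero => exact fun _ _ _ h => absurd h (Nat.not_lt_zero _)
  | succ n ih =>
    intro c c' w hw
    -- The induction hypothesis equates coefficients only up to a given length, so it cannot be
    -- rewritten as an identity of series inside a shuffle; `shuffle_congr` transfers it. Taking `e
    -- = emptySeries` recovers the bare statement.
    have key : ∀ (e : Series K) (a : Fin 2) (w : Word), w.length < n →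
        shuffle e (mixComp (shift a (shuffle c c')) d) w =
          shuffle e (shuffle (mixComp (shift a c) d) (mixComp c' d) +
            shuffle (mixComp c d) (mixComp (shift a c') d)) w := fun e a w hw =>
      shuffle_congr (fun _ _ => rfl) (fun v hv => by
        rw [shift_shuffle, mixComp_add, Pi.add_apply, Pi.add_apply, ih _ _ v hv, ih _ _ v hv]) hw
    have key' := key emptySeries
    simp only [emptySeries_shuffle] at key'
    match w with
    | [] => simp only [shuffle_nil, mixComp_nil]
    | 0 :: w =>
      have hw : w.length < n := Nat.lt_of_succ_lt_succ hw
      refine apply_cons_congr ?_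
      rw [shift_zero_mixComp, Pi.add_apply, key _ _ _ hw,
        key' _ _ hw, ← Pi.add_apply]
      refine congrFun ?_ w
      rw [shift_shuffle, shift_zero_mixComp, shift_zero_mixComp]
      simp only [shuffle_add, add_shuffle]
      rw [shuffle_assoc (d 1), show shuffle (d 1) (shuffle (mixComp c d) (mixComp (shift 1 c') d)) =
        shuffle (mixComp c d) (shuffle (d 1) (mixComp (shift 1 c') d)) by ac_rfl]
      abel
    | 1 :: w =>
      have hw : w.length < n := Nat.lt_of_succ_lt_succ hw
      refine apply_cons_congr ?_
      rw [shift_one_mixComp, key _ _ _ hw]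
      refine congrFun ?_ w
      rw [shift_shuffle, shift_one_mixComp, shift_one_mixComp]
      simp only [shuffle_add]
      congr 1 <;> ac_rfl

/-- The pair on the right is the star product of `d` and `e`: it is what the two chain rules produce
when applied in succession. -/
theorem mixComp_mixComp (c : Series K) (d e : SeriesPair K) :
    mixComp (mixComp c d) e = mixComp c ![shuffle (mixComp (d 0) e) (e 0),
      mixComp (d 1) e + shuffle (mixComp (d 0) e) (e 1)] := by
  set f : SeriesPair K := ![shuffle (mixComp (d 0) e) (e 0),
      mixComp (d 1) e + shuffle (mixComp (d 0) e) (e 1)] with hf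
  have hf0 : f 0 = shuffle (mixComp (d 0) e) (e 0) := rfl
  have hf1 : f 1 = mixComp (d 1) e + shuffle (mixComp (d 0) e) (e 1) := rfl
  suffices h : ∀ (n : ℕ) (c : Series K) (w : Word), w.length < n →
      mixComp (mixComp c d) e w = mixComp c f w from
    funext fun w => h _ c w (Nat.lt_succ_self _)
  intro n
  induction n with
  | zero => exact fun _ _ h => absurd h (Nat.not_lt_zero _)
  | succ n ih =>
    intro c w hw
    match w with
    | [] => simp only [mixComp_nil]
    | 0 :: w =>
      have hw : w.length < n := Nat.lt_of_succ_lt_succ hw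
      refine apply_cons_congr ?_
      rw [shift_zero_mixComp, shift_zero_mixComp c f, Pi.add_apply,
        Pi.add_apply, ← ih _ w hw,
        ← shuffle_congr (fun _ _ => rfl) (fun v hv => ih (shift 1 c) v hv) hw,
        ← Pi.add_apply, ← Pi.add_apply]
      refine congrFun ?_ w
      rw [shift_zero_mixComp, shift_one_mixComp, mixComp_add, mixComp_shuffle, mixComp_shuffle,
        hf1, add_shuffle, add_assoc]
      congr 2
      ac_rfl
    | 1 :: w =>
      have hw : w.length < n := Nat.lt_of_succ_lt_succ hw
      refine apply_cons_congr ?_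
      rw [shift_one_mixComp, shift_one_mixComp c f,
        ← shuffle_congr (fun _ _ => rfl) (fun v hv => ih (shift 1 c) v hv) hw]
      refine congrFun ?_ w
      rw [shift_one_mixComp, mixComp_shuffle, hf0]
      ac_rfl

theorem mixComp_unit (c : Series K) : mixComp c ![emptySeries, 0] = c := by
  ext w
  induction w generalizing c with
  | nil => exact mixComp_nil _ _
  | cons a w ih =>
    fin_cases a
    · change shift 0 (mixComp c _) w = shift 0 c w
      rw [shift_zero_mixComp, Pi.add_apply, ih, shuffle_comm]
      simp [shuffle_zero]
    · change shift 1 (mixComp c _) w = shift 1 c w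
      rw [shift_one_mixComp]
      simp [emptySeries_shuffle, ih]

/-- Each insertion of `d 0` or `d 1` is preceded by a letter, so only values of `d` at strictly
shorter words matter. This gain of one makes `G.star` triangular. -/
theorem mixComp_congr {c : Series K} {d d' : SeriesPair K} {n : ℕ}
    (hd : ∀ i, ∀ v : Word, v.length < n → d i v = d' i v) {w : Word} (hw : w.length ≤ n) :
    mixComp c d w = mixComp c d' w := by
  induction n generalizing c w with
  | zero =>
    obtain rfl := List.length_eq_zero_iff.1 (Nat.le_zero.1 hw)
    simp only [mixComp_nil]
  | succ n ih =>
    have ih' : ∀ c : Series K, ∀ v : Word, v.length < n + 1 → mixComp c d v = mixComp c d' v :=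
      fun c v hv => ih (fun i v hv => hd i v (by omega)) (Nat.lt_succ_iff.1 hv)
    match w with
    | [] => simp only [mixComp_nil]
    | 0 :: w =>
      have hw : w.length < n + 1 := hw
      refine apply_cons_congr ?_
      rw [shift_zero_mixComp, shift_zero_mixComp, Pi.add_apply,
        Pi.add_apply, ih' _ w hw, shuffle_congr (hd 1) (ih' _) hw]
    | 1 :: w =>
      have hw : w.length < n + 1 := hw
      refine apply_cons_congr ?_
      rw [shift_one_mixComp, shift_one_mixComp,
        shuffle_congr (hd 0) (ih' _) hw]

end MixComp

/-! ### Polynomial dependence of coefficients, via closure in any subalgebra of functions. -/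

section Polynomiality

variable {K : Type*} [Field K] {P : Type*} {S : Subalgebra K (P → K)}

theorem shuffle_mem {c d : P → Series K} (hc : ∀ w, (fun p => c p w) ∈ S)
    (hd : ∀ w, (fun p => d p w) ∈ S) (w : Word) : (fun p => shuffle (c p) (d p) w) ∈ S := by
  induction w generalizing c d with
  | nil =>
    simp only [shuffle_nil]
    exact mul_mem (hc []) (hd [])
  | cons a w ih =>
    simp only [shuffle_cons]
    exact add_mem (ih (c := fun p => shift a (c p)) (fun w => hc (a :: w)) hd)
      (ih (d := fun p => shift a (d p)) hc fun w => hd (a :: w))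

theorem prepend_mem {c : P → Series K} (hc : ∀ w, (fun p => c p w) ∈ S) (a : Fin 2) (w : Word) :
    (fun p => prepend a (c p) w) ∈ S := by
  cases w with
  | nil => exact zero_mem S
  | cons b w =>
    simp only [prepend_cons]
    split_ifs
    exacts [hc w, zero_mem S]

theorem emptySeries_mem (w : Word) : (fun _ : P => (emptySeries w : K)) ∈ S :=
  S.algebraMap_mem _

theorem wordMixComp_mem {d : P → SeriesPair K} (hd : ∀ i w, (fun p => d p i w) ∈ S)
    (η w : Word) : (fun p => wordMixComp (d p) η w) ∈ S := by
  induction η generalizing w with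
  | nil => exact emptySeries_mem w
  | cons a η ih =>
    simp only [wordMixComp]
    split_ifs
    · exact prepend_mem ih 0 w
    · exact add_mem (prepend_mem (shuffle_mem (hd 0) ih) 1 w)
        (prepend_mem (shuffle_mem (hd 1) ih) 0 w)

theorem mixComp_mem {c : P → Series K} {d : P → SeriesPair K} (hc : ∀ w, (fun p => c p w) ∈ S)
    (hd : ∀ i w, (fun p => d p i w) ∈ S) (w : Word) : (fun p => mixComp (c p) (d p) w) ∈ S := by
  have h : (fun p => mixComp (c p) (d p) w) =
      ∑ η ∈ words w.length, (fun p => c p η) * fun p => wordMixComp (d p) η w := by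
    ext p
    simp [mixComp_eq_partialMixComp _ _ (Nat.le_refl w.length), partialMixComp, Finset.sum_apply]
  rw [h]
  exact sum_mem fun η _ => mul_mem (hc η) (wordMixComp_mem hd η w)

end Polynomiality

end AffineFeedback

namespace AffineFeedback

/-! ### Separating points and evaluation on tensor products. -/

section Separation

variable {K : Type*} [Field K]
variable {A B C : Type*} [CommRing A] [Algebra K A] [CommRing B] [Algebra K B]
  [CommRing C] [Algebra K C]

/-- The point of `A ⊗ B` given by a point of `A` and a point of `B`. -/
noncomputable def evalTensor (f : A →ₐ[K] K) (g : B →ₐ[K] K) : A ⊗[K] B →ₐ[K] K :=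
  Algebra.TensorProduct.lift f g fun _ _ => Commute.all _ _

@[simp]
theorem evalTensor_tmul (f : A →ₐ[K] K) (g : B →ₐ[K] K) (a : A) (b : B) :
    evalTensor f g (a ⊗ₜ b) = f a * g b :=
  Algebra.TensorProduct.lift_tmul _ _ _ _ _

/-- A family of points of an algebra separates its elements. -/
def Separates {P : Type*} (ev : P → A →ₐ[K] K) : Prop :=
  ∀ a b : A, (∀ p, ev p a = ev p b) → a = b

theorem separates_of_eq_zero {P : Type*} {ev : P → A →ₐ[K] K}
    (h : ∀ a : A, (∀ p, ev p a = 0) → a = 0) : Separates ev := fun a b hab =>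
  sub_eq_zero.1 (h _ fun p => by rw [map_sub, hab p, sub_self])

/-- Expand in a basis of `B`. Once `p` is fixed, separation in `B` kills the resulting combination
of basis vectors, hence every `ev p (x i)`; separation in `A` then kills `x i`. -/
theorem Separates.tensor {P Q : Type*} {ev : P → A →ₐ[K] K} {ev' : Q → B →ₐ[K] K}
    (h : Separates ev) (h' : Separates ev') :
    Separates fun p : P × Q => evalTensor (ev p.1) (ev' p.2) := by
  classical
  refine separates_of_eq_zero fun t ht => ?_
  let b := Module.Basis.ofVectorSpace K B
  obtain ⟨x, rfl⟩ := (TensorProduct.equivFinsuppOfBasisRight (M := A) b).symm.surjective t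
  rw [TensorProduct.equivFinsuppOfBasisRight_symm_apply] at ht ⊢
  suffices hx : x = 0 by simp [hx]
  have key : ∀ p, x.sum (fun i a => ev p a • b i) = 0 := fun p => h' _ _ fun q => by
    rw [map_zero, ← ht (p, q)]
    simp [Finsupp.sum, map_sum]
  ext i
  refine h _ _ fun p => ?_
  have := congrArg (fun y => b.repr y i) (key p)
  rw [Finsupp.zero_apply, map_zero]
  by_contra hne
  have hx : ¬x i = 0 → ev p (x i) = 0 := by
    simpa [Finsupp.sum, map_sum, Finsupp.single_apply, Finset.sum_apply'] using this
  exact hne (hx fun h => hne (by rw [h, map_zero]))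

/-- Lets a linear map in one tensor slot be traded for a change of the point in that slot. -/
theorem evalTensor_rTensor {f : A →ₐ[K] K} {f' : B →ₐ[K] K} (g : C →ₐ[K] K) {L : A →ₗ[K] B}
    (h : ∀ a, f' (L a) = f a) (t : A ⊗[K] C) :
    evalTensor f' g (L.rTensor C t) = evalTensor f g t := by
  induction t with
  | zero => simp
  | add x y hx hy => simp only [map_add, hx, hy]
  | tmul a c => simp [h]

theorem evalTensor_lTensor {f : A →ₐ[K] K} {f' : B →ₐ[K] K} (g : C →ₐ[K] K) {L : A →ₗ[K] B}
    (h : ∀ a, f' (L a) = f a) (t : C ⊗[K] A) :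
    evalTensor g f' (L.lTensor C t) = evalTensor g f t := by
  induction t with
  | zero => simp
  | add x y hx hy => simp only [map_add, hx, hy]
  | tmul a c => simp [h]

theorem evalTensor_assoc (f : A →ₐ[K] K) (g : B →ₐ[K] K) (h : C →ₐ[K] K) (t : (A ⊗[K] B) ⊗[K] C) :
    evalTensor f (evalTensor g h) (TensorProduct.assoc K A B C t) =
      evalTensor (evalTensor f g) h t := by
  induction t with
  | zero => simp
  | add x y hx hy => simp only [map_add, hx, hy]
  | tmul x c =>
    induction x with
    | zero => simp
    | add x y hx hy => simp only [map_add, TensorProduct.add_tmul, hx, hy]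
    | tmul a b => simp [mul_assoc]

theorem eval_lid (f : A →ₐ[K] K) (t : K ⊗[K] A) :
    f (TensorProduct.lid K A t) = evalTensor (AlgHom.id K K) f t := by
  induction t with
  | zero => simp
  | add x y hx hy => simp only [map_add, hx, hy]
  | tmul k a => simp

theorem eval_rid (f : A →ₐ[K] K) (t : A ⊗[K] K) :
    f (TensorProduct.rid K A t) = evalTensor f (AlgHom.id K K) t := by
  induction t with
  | zero => simp
  | add x y hx hy => simp only [map_add, hx, hy]
  | tmul k a => simp [mul_comm]

theorem eval_mul' (f : A →ₐ[K] K) (t : A ⊗[K] A) :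
    f (LinearMap.mul' K A t) = evalTensor f f t := by
  induction t with
  | zero => simp
  | add x y hx hy => simp only [map_add, hx, hy]
  | tmul k a => simp

/-- Multiplication in `B` is dual to the diagonal, so the same point `h` acts on both factors. -/
theorem evalTensor_tensorCoaction {f f' g g' : A →ₐ[K] K} {h : B →ₐ[K] K}
    {ρ : A →ₗ[K] A ⊗[K] B} (hf : ∀ a, evalTensor f h (ρ a) = f' a)
    (hg : ∀ a, evalTensor g h (ρ a) = g' a) (t : A ⊗[K] A) :
    evalTensor (evalTensor f g) h (tensorCoaction ρ ρ t) = evalTensor f' g' t := by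
  have key : ∀ s : (A ⊗[K] B) ⊗[K] (A ⊗[K] B),
      evalTensor (evalTensor f g) h ((LinearMap.mul' K B).lTensor (A ⊗[K] A)
        (TensorProduct.tensorTensorTensorComm K A B A B s)) =
      evalTensor (evalTensor f h) (evalTensor g h) s := fun s => by
    induction s with
    | zero => simp
    | add x y hx hy => simp only [map_add, hx, hy]
    | tmul x y =>
      induction x with
      | zero => simp
      | add x x' hx hx' => simp only [map_add, TensorProduct.add_tmul, hx, hx']
      | tmul a b =>
        induction y with
        | zero => simp
        | add x x' hx hx' => simp only [map_add, TensorProduct.tmul_add, hx, hx']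
        | tmul a' b' =>
          simp
          ring
  rw [tensorCoaction, LinearMap.comp_apply, LinearMap.comp_apply, LinearEquiv.coe_coe, key]
  induction t with
  | zero => simp
  | add x y hx hy => simp only [map_add, hx, hy]
  | tmul a b => simp [hf, hg]

end Separation

/-! ### Elements of `H` as functions on `G`. -/

section Coordinates

variable {K : Type*} [Field K]

theorem algHom_ext_coord {A : Type*} [CommRing A] [Algebra K A] {φ ψ : H K →ₐ[K] A}
    (h : ∀ η i, φ (coord K η i) = ψ (coord K η i)) : φ = ψ := by
  refine Ideal.Quotient.algHom_ext K (MvPolynomial.algHom_ext fun p => ?_)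
  exact h p.1 p.2

theorem coord_nil_zero : coord K [] 0 = 1 := by
  refine sub_eq_zero.1 (?_ : Ideal.Quotient.mk (Ideal.span
    {(MvPolynomial.X (([] : Word), (0 : Fin 2)) - 1 : MvPolynomial (Word × Fin 2) K)})
    (MvPolynomial.X (([] : Word), (0 : Fin 2)) - 1) = 0)
  exact Ideal.Quotient.eq_zero_iff_mem.2 (Ideal.mem_span_singleton_self _)

theorem exists_algHom_coord {A : Type*} [CommRing A] [Algebra K A] (v : Word → Fin 2 → A)
    (hv : v [] 0 = 1) : ∃ φ : H K →ₐ[K] A, ∀ η i, φ (coord K η i) = v η i := by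
  refine ⟨Ideal.Quotient.liftₐ _ (MvPolynomial.aeval fun p : Word × Fin 2 => v p.1 p.2) ?_,
    fun η i => ?_⟩
  · intro a ha
    obtain ⟨b, rfl⟩ := Ideal.mem_span_singleton'.1 ha
    simp [hv]
  · exact MvPolynomial.aeval_X _ (η, i)

theorem evalAt_coord (c : G K) (η : Word) (i : Fin 2) : evalAt c (coord K η i) = c.1 i η :=
  MvPolynomial.aeval_X _ (η, i)

theorem separates_evalAt [Infinite K] : Separates (evalAt : G K → H K →ₐ[K] K) := by
  classical
  refine separates_of_eq_zero fun a ha => ?_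
  obtain ⟨p, rfl⟩ : ∃ p : MvPolynomial (Word × Fin 2) K,
      MvPolynomial.aeval (fun q : Word × Fin 2 => coord K q.1 q.2) p = a := by
    obtain ⟨p, rfl⟩ := Ideal.Quotient.mk_surjective a
    refine ⟨p, ?_⟩
    have h : MvPolynomial.aeval (fun q : Word × Fin 2 => coord K q.1 q.2) =
        (Ideal.Quotient.mkₐ K _ : MvPolynomial (Word × Fin 2) K →ₐ[K] H K) :=
      MvPolynomial.algHom_ext fun q => MvPolynomial.aeval_X _ q
    exact AlgHom.congr_fun h p
  -- Setting the variable of `1 ε₁` to 1 does not change the class in `H K`, and the values of the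
  -- result at arbitrary `v` are values at points of `G K`. A polynomial vanishing everywhere over
  -- an infinite field is zero.
  let τ : MvPolynomial (Word × Fin 2) K →ₐ[K] MvPolynomial (Word × Fin 2) K :=
    MvPolynomial.aeval fun q => if q = ([], 0) then 1 else MvPolynomial.X q
  have hτ : ((MvPolynomial.aeval fun q : Word × Fin 2 => coord K q.1 q.2).comp τ :
      MvPolynomial (Word × Fin 2) K →ₐ[K] H K) =
      MvPolynomial.aeval fun q : Word × Fin 2 => coord K q.1 q.2 := by
    refine MvPolynomial.algHom_ext fun q => ?_
    simp only [τ, AlgHom.comp_apply, MvPolynomial.aeval_X]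
    split_ifs with h
    · rw [h, map_one, coord_nil_zero]
    · rw [MvPolynomial.aeval_X]
  rw [← hτ, AlgHom.comp_apply]
  suffices h : τ p = 0 by rw [h, map_zero]
  refine MvPolynomial.funext fun v => ?_
  rw [map_zero]
  let c : G K := ⟨fun i η => if (η, i) = ([], 0) then 1 else v (η, i), by simp⟩
  rw [← ha c, ← MvPolynomial.coe_aeval_eq_eval, RingHom.coe_coe, ← AlgHom.comp_apply,
    ← AlgHom.comp_apply]
  refine AlgHom.congr_fun (MvPolynomial.algHom_ext fun q => ?_) p
  simp only [τ, AlgHom.comp_apply, MvPolynomial.aeval_X, evalAt_coord, c]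
  split_ifs <;> simp

theorem separates_evalAt₂ [Infinite K] :
    Separates fun p : G K × G K => evalTensor (evalAt p.1) (evalAt p.2) :=
  separates_evalAt.tensor separates_evalAt

theorem Dualizes.evalTensor_apply {φ : H K →ₐ[K] H K ⊗[K] H K} {op : G K → G K → G K}
    (h : Dualizes φ op) (c d : G K) (a : H K) :
    evalTensor (evalAt c) (evalAt d) (φ a) = evalAt (op c d) a := by
  have : (evalTensor (evalAt c) (evalAt d)).comp φ = evalAt (op c d) :=
    algHom_ext_coord fun η i => (h η i c d).trans (evalAt_coord _ _ _).symm
  exact AlgHom.congr_fun this a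

theorem Dualizes.unique [Infinite K] {φ ψ : H K →ₐ[K] H K ⊗[K] H K} {op : G K → G K → G K}
    (h : Dualizes φ op) (h' : Dualizes ψ op) : φ = ψ :=
  AlgHom.ext fun a => separates_evalAt₂ _ _ fun p => by
    rw [h.evalTensor_apply, h'.evalTensor_apply]

end Coordinates

/-! ### Dualizing polynomial operations, and inverting triangular ones. -/

section PolynomialMaps

universe u

variable {K : Type u} [Field K]

/-- The coordinates of a map to `G` belong to a given algebra of functions. -/
def HasCoordsIn {P : Type*} (S : Subalgebra K (P → K)) (c : P → G K) : Prop :=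
  ∀ i w, (fun p => (c p).1 i w) ∈ S

/-- A binary operation on `G` is polynomial if it preserves maps with coordinates in any given
algebra of functions. -/
def IsPolynomialOp (op : G K → G K → G K) : Prop :=
  ∀ {P : Type u} {S : Subalgebra K (P → K)} {c d : P → G K}, HasCoordsIn S c → HasCoordsIn S d →
    HasCoordsIn S fun p => op (c p) (d p)

/-- The functions on a family of points given by the elements of an algebra. -/
def functionsOn {P A : Type*} [CommRing A] [Algebra K A] (ev : P → A →ₐ[K] K) :
    Subalgebra K (P → K) := (AlgHom.pi ev).range

theorem mem_functionsOn {P A : Type*} [CommRing A] [Algebra K A] {ev : P → A →ₐ[K] K}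
    {f : P → K} : f ∈ functionsOn ev ↔ ∃ a, ∀ p, ev p a = f p :=
  ⟨fun ⟨a, ha⟩ => ⟨a, fun p => congrFun ha p⟩, fun ⟨a, ha⟩ => ⟨a, funext ha⟩⟩

/-- Lifts of the coordinate functions to `A` respect the relation `1 ε₁ = 𝟏` because points separate
`A`. -/
theorem HasCoordsIn.exists_algHom {P A : Type*} [CommRing A] [Algebra K A] {ev : P → A →ₐ[K] K}
    (hev : Separates ev) {c : P → G K} (hc : HasCoordsIn (functionsOn ev) c) :
    ∃ φ : H K →ₐ[K] A, ∀ p a, ev p (φ a) = evalAt (c p) a := by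
  choose v hv using fun η i => mem_functionsOn.1 (hc i η)
  obtain ⟨φ, hφ⟩ := exists_algHom_coord (K := K) v
    (hev _ _ fun p => by rw [hv, map_one, (c p).2])
  refine ⟨φ, fun p a => ?_⟩
  have : (ev p).comp φ = evalAt (c p) := algHom_ext_coord fun η i => by
    rw [AlgHom.comp_apply, hφ, hv, evalAt_coord]
  exact AlgHom.congr_fun this a

theorem IsPolynomialOp.existsUnique_dualizes [Infinite K] {op : G K → G K → G K}
    (h : IsPolynomialOp op) : ∃! φ : H K →ₐ[K] H K ⊗[K] H K, Dualizes φ op := by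
  -- The universal case: the two projections of `G × G`, whose coordinates are represented by `coord
  -- ⊗ 1` and `1 ⊗ coord`.
  obtain ⟨φ, hφ⟩ := (h (P := G K × G K) (c := Prod.fst) (d := Prod.snd)
    (S := functionsOn fun p : G K × G K => evalTensor (evalAt p.1) (evalAt p.2))
    (fun i w => mem_functionsOn.2 ⟨coord K w i ⊗ₜ 1, fun p => by simp [evalAt_coord]⟩)
    (fun i w => mem_functionsOn.2 ⟨1 ⊗ₜ coord K w i, fun p => by simp [evalAt_coord]⟩)).exists_algHom
      separates_evalAt₂
  have hφ' : Dualizes φ op := fun η i c d => (hφ (c, d) _).trans (evalAt_coord _ _ _)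
  exact ⟨φ, hφ', fun ψ hψ => hψ.unique hφ'⟩

/-- The pair `[1 0]`, the unit of the products on `G`. -/
def G.one : G K := ⟨![emptySeries, 0], by simp [emptySeries]⟩

theorem counitH_eq : counitH K = evalAt (G.one : G K) := by
  refine algHom_ext_coord fun η i => ?_
  rw [evalAt_coord]
  refine (MvPolynomial.aeval_X _ (η, i)).trans ?_
  fin_cases i <;> simp [G.one, emptySeries]

/-- The value of `op c d` at a word `w` is that of `d`, up to a quantity that depends on `c` and on
the values of `d` at the words shorter than `w`. -/
def IsTriangularOp (op : G K → G K → G K) : Prop :=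
  ∀ (c d d' : G K) (i : Fin 2) (w : Word),
    (∀ j, ∀ v : Word, v.length < w.length → d.1 j v = d'.1 j v) →
    (op c d).1 i w - (op c d').1 i w = d.1 i w - d'.1 i w

/-- The iterates of `d ↦ d + 1 - op c d`, starting at the unit. -/
def approxInv (op : G K → G K → G K) (c : G K) : ℕ → G K
  | 0 => G.one
  | n + 1 => ⟨(approxInv op c n).1 + G.one.1 - (op c (approxInv op c n)).1, by
      simp [(approxInv op c n).2, (op c (approxInv op c n)).2, (G.one : G K).2]⟩

theorem approxInv_succ_apply (op : G K → G K → G K) (c : G K) (n : ℕ) (i : Fin 2) (w : Word) :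
    (approxInv op c (n + 1)).1 i w =
      (approxInv op c n).1 i w + G.one.1 i w - (op c (approxInv op c n)).1 i w := rfl

/-- By triangularity, `d + 1 - op c d` at `w` depends on `d` only at shorter words, so each
iteration fixes one more degree. -/
theorem IsTriangularOp.approxInv_succ {op : G K → G K → G K} (h : IsTriangularOp op) (c : G K)
    (n : ℕ) (i : Fin 2) {w : Word} (hw : w.length < n) :
    (approxInv op c (n + 1)).1 i w = (approxInv op c n).1 i w := by
  induction n generalizing i w with
  | zero => exact absurd hw (Nat.not_lt_zero _)
  | succ n ih =>
    have := h c (approxInv op c (n + 1)) (approxInv op c n) i w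
      fun j v hv => ih j (by omega)
    rw [approxInv_succ_apply _ _ (n + 1), approxInv_succ_apply _ _ n] at *
    linear_combination -this

theorem IsTriangularOp.approxInv_eq {op : G K → G K → G K} (h : IsTriangularOp op) (c : G K)
    {m n : ℕ} (hmn : m ≤ n) (i : Fin 2) {w : Word} (hw : w.length < m) :
    (approxInv op c n).1 i w = (approxInv op c m).1 i w := by
  induction n, hmn using Nat.le_induction with
  | base => rfl
  | succ n hn ih => rw [h.approxInv_succ c n i (by omega), ih]

/-- The limit of the iterates of `d ↦ d + 1 - op c d`. -/
def rightInv (op : G K → G K → G K) (c : G K) : G K :=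
  ⟨fun i w => (approxInv op c (w.length + 1)).1 i w, (approxInv op c 1).2⟩

theorem IsTriangularOp.op_rightInv {op : G K → G K → G K} (h : IsTriangularOp op) (c : G K) :
    op c (rightInv op c) = G.one := by
  refine Subtype.ext (funext fun i => funext fun w => ?_)
  -- Iterate number `w.length + 1` is already stationary at `w`, so there `op c` of it equals the
  -- unit; `h2` carries this over to the limit, which agrees with it at shorter words.
  have h1 := h.approxInv_succ c (w.length + 1) i (Nat.lt_succ_self w.length)
  have h2 := h c (rightInv op c) (approxInv op c (w.length + 1)) i w fun j v hv =>
    (h.approxInv_eq c (by omega) j (Nat.lt_succ_self _)).symm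
  rw [approxInv_succ_apply] at h1
  have h3 : (rightInv op c).1 i w = (approxInv op c (w.length + 1)).1 i w := rfl
  linear_combination h2 + h3 - h1

theorem hasCoordsIn_one {P : Type*} {S : Subalgebra K (P → K)} :
    HasCoordsIn S fun _ : P => (G.one : G K) := fun _ _ => S.algebraMap_mem _

theorem IsPolynomialOp.rightInv {op : G K → G K → G K} (h : IsPolynomialOp op)
    {P : Type u} {S : Subalgebra K (P → K)} {c : P → G K} (hc : HasCoordsIn S c) :
    HasCoordsIn S fun p => rightInv op (c p) := by
  have key : ∀ n, HasCoordsIn S fun p => approxInv op (c p) n := fun n => by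
    induction n with
    | zero => exact hasCoordsIn_one
    | succ n ih => exact fun i w => sub_mem (add_mem (ih i w) (hasCoordsIn_one i w)) (h hc ih i w)
  exact fun i w => key (w.length + 1) i w

/-- The coordinates of the right inverse are polynomial. -/
theorem IsPolynomialOp.exists_algHom_rightInv [Infinite K] {op : G K → G K → G K}
    (h : IsPolynomialOp op) :
    ∃ S : H K →ₐ[K] H K, ∀ c a, evalAt c (S a) = evalAt (AffineFeedback.rightInv op c) a :=
  (h.rightInv (P := G K) (c := id) (S := functionsOn evalAt)
    fun i w => mem_functionsOn.2 ⟨coord K w i, fun p => evalAt_coord p w i⟩).exists_algHom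
      separates_evalAt

theorem Dualizes.isBialgebra [Infinite K] {op : G K → G K → G K} {Δ : H K →ₐ[K] H K ⊗[K] H K}
    (h : Dualizes Δ op) (op_assoc : ∀ c d e, op (op c d) e = op c (op d e))
    (one_op : ∀ c, op G.one c = c) (op_one : ∀ c, op c G.one = c) :
    IsBialgebra Δ (counitH K) where
  coassoc := LinearMap.ext fun a =>
    (separates_evalAt.tensor separates_evalAt₂) _ _ fun ⟨c, d, e⟩ => by
      simp only [LinearMap.comp_apply, LinearEquiv.coe_coe, evalTensor_assoc]
      rw [evalTensor_rTensor _ (h.evalTensor_apply c d), evalTensor_lTensor _ (h.evalTensor_apply d e)]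
      simp only [AlgHom.toLinearMap_apply, h.evalTensor_apply, op_assoc]
  counit_left := LinearMap.ext fun a => separates_evalAt _ _ fun c => by
    simp only [LinearMap.comp_apply, LinearEquiv.coe_coe, eval_lid]
    rw [evalTensor_rTensor (f := evalAt G.one) _ (fun a => by rw [← counitH_eq]; rfl)]
    simp only [AlgHom.toLinearMap_apply, h.evalTensor_apply, one_op, LinearMap.id_apply]
  counit_right := LinearMap.ext fun a => separates_evalAt _ _ fun c => by
    simp only [LinearMap.comp_apply, LinearEquiv.coe_coe, eval_rid]
    rw [evalTensor_lTensor (f := evalAt G.one) _ (fun a => by rw [← counitH_eq]; rfl)]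
    simp only [AlgHom.toLinearMap_apply, h.evalTensor_apply, op_one, LinearMap.id_apply]

theorem Dualizes.isAntipode [Infinite K] {op : G K → G K → G K} {Δ : H K →ₐ[K] H K ⊗[K] H K}
    (h : Dualizes Δ op) {inv : G K → G K} {S : H K →ₐ[K] H K}
    (hS : ∀ c a, evalAt c (S a) = evalAt (inv c) a) (inv_op : ∀ c, op (inv c) c = G.one)
    (op_inv : ∀ c, op c (inv c) = G.one) : IsAntipode Δ (counitH K) S.toLinearMap where
  left := LinearMap.ext fun a => separates_evalAt _ _ fun c => by
    simp only [LinearMap.comp_apply, eval_mul']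
    rw [evalTensor_rTensor _ (hS c)]
    simp only [AlgHom.toLinearMap_apply, h.evalTensor_apply, inv_op, counitH_eq,
      Algebra.linearMap_apply, AlgHom.commutes]
    rfl
  right := LinearMap.ext fun a => separates_evalAt _ _ fun c => by
    simp only [LinearMap.comp_apply, eval_mul']
    rw [evalTensor_lTensor _ (hS c)]
    simp only [AlgHom.toLinearMap_apply, h.evalTensor_apply, op_inv, counitH_eq,
      Algebra.linearMap_apply, AlgHom.commutes]
    rfl

/-- In a monoid with right inverses, `c` equals `inv (inv c)`, hence is a right inverse of `inv c`.
-/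
theorem op_left_inv {op : G K → G K → G K} {inv : G K → G K}
    (op_assoc : ∀ c d e, op (op c d) e = op c (op d e))
    (one_op : ∀ c, op G.one c = c) (op_one : ∀ c, op c G.one = c)
    (op_inv : ∀ c, op c (inv c) = G.one) (c : G K) : op (inv c) c = G.one := by
  have h : c = inv (inv c) := by
    rw [← one_op (inv (inv c)), ← op_inv c, op_assoc, op_inv, op_one]
  nth_rewrite 2 [h]
  exact op_inv _

end PolynomialMaps

end AffineFeedback

namespace AffineFeedback

/-! ### The two group laws, the action, and their duals. -/

section Operations

universe u

variable {K : Type u} [Field K]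

theorem G.ext {c d : G K} (h₀ : c.1 0 = d.1 0) (h₁ : c.1 1 = d.1 1) : c = d :=
  Subtype.ext (funext fun i => by fin_cases i; exacts [h₀, h₁])

theorem G.dot_zero (c d : G K) : (G.dot c d).1 0 = shuffle (c.1 0) (d.1 0) := rfl

theorem G.dot_one (c d : G K) : (G.dot c d).1 1 = c.1 1 + shuffle (c.1 0) (d.1 1) := rfl

theorem G.act_apply (c d : G K) (i : Fin 2) : (G.act c d).1 i = mixComp (c.1 i) d.1 := rfl

theorem G.one_zero : (G.one : G K).1 0 = emptySeries := rfl

theorem G.one_one : (G.one : G K).1 1 = 0 := rfl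

theorem G.dot_assoc (c d e : G K) : G.dot (G.dot c d) e = G.dot c (G.dot d e) := by
  apply G.ext <;> simp only [G.dot_zero, G.dot_one, shuffle_assoc, shuffle_add, add_assoc]

theorem G.one_dot (c : G K) : G.dot G.one c = c := by
  apply G.ext <;> simp only [G.dot_zero, G.dot_one, G.one_zero, G.one_one, emptySeries_shuffle,
    zero_add]

theorem G.dot_one_right (c : G K) : G.dot c G.one = c := by
  apply G.ext <;> simp only [G.dot_zero, G.dot_one, G.one_zero, G.one_one, shuffle_emptySeries,
    shuffle_zero, add_zero]

theorem G.dot_act (c d e : G K) : G.act (G.dot c d) e = G.dot (G.act c e) (G.act d e) := by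
  apply G.ext <;> simp only [G.dot_zero, G.dot_one, G.act_apply, mixComp_shuffle, mixComp_add]

theorem G.one_act (c : G K) : G.act G.one c = G.one := by
  apply G.ext <;> simp only [G.act_apply, G.one_zero, G.one_one, mixComp_emptySeries, mixComp_zero]

theorem G.act_one (c : G K) : G.act c G.one = c :=
  Subtype.ext (funext fun _ => mixComp_unit _)

theorem G.act_act (c d e : G K) : G.act (G.act c d) e = G.act c (G.star d e) :=
  Subtype.ext (funext fun _ => mixComp_mixComp _ _ _)

theorem G.star_assoc (c d e : G K) : G.star (G.star c d) e = G.star c (G.star d e) := by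
  rw [G.star, G.star, G.dot_act, G.act_act, G.dot_assoc]
  rfl

theorem G.one_star (c : G K) : G.star G.one c = c := by
  rw [G.star, G.one_act, G.one_dot]

theorem G.star_one (c : G K) : G.star c G.one = c := by
  rw [G.star, G.act_one, G.dot_one_right]

theorem isPolynomialOp_dot : IsPolynomialOp (G.dot : G K → G K → G K) := by
  intro P S c d hc hd i w
  fin_cases i
  · exact shuffle_mem (hc 0) (hd 0) w
  · exact add_mem (hc 1 w) (shuffle_mem (hc 0) (hd 1) w)

theorem isPolynomialOp_act : IsPolynomialOp (G.act : G K → G K → G K) :=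
  fun hc hd i w => mixComp_mem (hc i) hd w

theorem isPolynomialOp_star : IsPolynomialOp (G.star : G K → G K → G K) :=
  fun hc hd => isPolynomialOp_dot (isPolynomialOp_act hc hd) hd

/-- The left factors are allowed to differ beyond the length of `w` because in `G.star` the left
factor `G.act c d` varies with `d`. -/
theorem G.dot_sub_dot {c c' d d' : G K} {i : Fin 2} {w : Word}
    (hc : ∀ j, ∀ v : Word, v.length ≤ w.length → c.1 j v = c'.1 j v)
    (hd : ∀ j, ∀ v : Word, v.length < w.length → d.1 j v = d'.1 j v) :
    (G.dot c d).1 i w - (G.dot c' d').1 i w = d.1 i w - d'.1 i w := by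
  fin_cases i
  · exact shuffle_sub_shuffle c'.2 (hc 0) (hd 0)
  · refine Eq.trans ?_ (shuffle_sub_shuffle c'.2 (hc 0) (hd 1))
    change c.1 1 w + shuffle (c.1 0) (d.1 1) w - (c'.1 1 w + shuffle (c'.1 0) (d'.1 1) w) = _
    rw [hc 1 w le_rfl, add_sub_add_left_eq_sub]
    rfl

theorem isTriangularOp_dot : IsTriangularOp (G.dot : G K → G K → G K) :=
  fun _ _ _ _ _ h => G.dot_sub_dot (fun _ _ _ => rfl) h

theorem isTriangularOp_star : IsTriangularOp (G.star : G K → G K → G K) :=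
  fun _ _ _ _ _ h => G.dot_sub_dot (fun _ _ hv => mixComp_congr h hv) h

theorem G.dot_rightInv (c : G K) : G.dot c (rightInv G.dot c) = G.one :=
  isTriangularOp_dot.op_rightInv c

theorem G.rightInv_dot (c : G K) : G.dot (rightInv G.dot c) c = G.one :=
  op_left_inv G.dot_assoc G.one_dot G.dot_one_right G.dot_rightInv c

theorem G.star_rightInv (c : G K) : G.star c (rightInv G.star c) = G.one :=
  isTriangularOp_star.op_rightInv c

theorem G.rightInv_star (c : G K) : G.star (rightInv G.star c) c = G.one :=
  op_left_inv G.star_assoc G.one_star G.star_one G.star_rightInv c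

/-- An endomorphism of a group preserves inverses. This is the colinearity of the antipode of `δ`.
-/
theorem G.rightInv_act (c d : G K) :
    G.act (rightInv G.dot c) d = rightInv G.dot (G.act c d) := by
  rw [← G.one_dot (G.act _ d), ← G.rightInv_dot (G.act c d), G.dot_assoc, ← G.dot_act,
    G.dot_rightInv, G.one_act, G.dot_one_right]

theorem isComoduleHom_unit (ρ : H K →ₐ[K] H K ⊗[K] H K) :
    IsComoduleHom (unitCoaction K (H K)) ρ.toLinearMap (Algebra.linearMap K (H K)) :=
  LinearMap.ext_ring (by simp [unitCoaction, Algebra.TensorProduct.one_def])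

variable [Infinite K] {δ ρ Δ : H K →ₐ[K] H K ⊗[K] H K}

theorem star_eq_comp (hδ : Dualizes δ G.dot) (hρ : Dualizes ρ G.act) (hΔ : Dualizes Δ G.star) :
    Δ.toLinearMap = (LinearMap.mul' K (H K)).lTensor (H K) ∘ₗ
      (TensorProduct.assoc K (H K) (H K) (H K)).toLinearMap ∘ₗ
        ρ.toLinearMap.rTensor (H K) ∘ₗ δ.toLinearMap :=
  LinearMap.ext fun a => separates_evalAt₂ _ _ fun ⟨c, d⟩ => by
    simp only [LinearMap.comp_apply, LinearEquiv.coe_coe]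
    rw [evalTensor_lTensor _ (eval_mul' (evalAt d)), evalTensor_assoc,
      evalTensor_rTensor _ (hρ.evalTensor_apply c d)]
    simp only [AlgHom.toLinearMap_apply, hδ.evalTensor_apply, hΔ.evalTensor_apply]
    rfl

theorem isHopfAlgebra_star (hΔ : Dualizes Δ G.star) : IsHopfAlgebra Δ (counitH K) := by
  obtain ⟨S, hS⟩ := IsPolynomialOp.exists_algHom_rightInv (isPolynomialOp_star (K := K))
  exact ⟨hΔ.isBialgebra G.star_assoc G.one_star G.star_one, S.toLinearMap,
    hΔ.isAntipode hS G.rightInv_star G.star_rightInv⟩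

theorem isRightCoaction_act (hρ : Dualizes ρ G.act) (hΔ : Dualizes Δ G.star) :
    IsRightCoaction Δ (counitH K) ρ.toLinearMap where
  coassoc := LinearMap.ext fun a =>
    (separates_evalAt.tensor separates_evalAt₂) _ _ fun ⟨c, d, e⟩ => by
      simp only [LinearMap.comp_apply, LinearEquiv.coe_coe, evalTensor_assoc]
      rw [evalTensor_rTensor _ (hρ.evalTensor_apply c d),
        evalTensor_lTensor _ (hΔ.evalTensor_apply d e)]
      simp only [AlgHom.toLinearMap_apply, hρ.evalTensor_apply, G.act_act]
  counit := LinearMap.ext fun a => separates_evalAt _ _ fun c => by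
    simp only [LinearMap.comp_apply, LinearEquiv.coe_coe, eval_rid]
    rw [evalTensor_lTensor (f := evalAt G.one) _ (fun a => by rw [← counitH_eq]; rfl)]
    simp only [AlgHom.toLinearMap_apply, hρ.evalTensor_apply, G.act_one, LinearMap.id_apply]

theorem isComoduleHom_mul' (hρ : Dualizes ρ G.act) :
    IsComoduleHom (tensorCoaction ρ.toLinearMap ρ.toLinearMap) ρ.toLinearMap
      (LinearMap.mul' K (H K)) :=
  LinearMap.ext fun t => separates_evalAt₂ _ _ fun ⟨c, e⟩ => by
    simp only [LinearMap.comp_apply]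
    rw [evalTensor_rTensor _ (eval_mul' (evalAt c)),
      evalTensor_tensorCoaction (hρ.evalTensor_apply c e) (hρ.evalTensor_apply c e),
      AlgHom.toLinearMap_apply, hρ.evalTensor_apply, eval_mul']

theorem isComoduleHom_dot (hδ : Dualizes δ G.dot) (hρ : Dualizes ρ G.act) :
    IsComoduleHom ρ.toLinearMap (tensorCoaction ρ.toLinearMap ρ.toLinearMap) δ.toLinearMap :=
  LinearMap.ext fun a => (separates_evalAt₂.tensor separates_evalAt) _ _ fun ⟨⟨c, d⟩, e⟩ => by
    simp only [LinearMap.comp_apply]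
    rw [evalTensor_tensorCoaction (hρ.evalTensor_apply c e) (hρ.evalTensor_apply d e),
      evalTensor_rTensor _ (hδ.evalTensor_apply c d)]
    simp only [AlgHom.toLinearMap_apply, hδ.evalTensor_apply, hρ.evalTensor_apply, G.dot_act]

theorem isComoduleHom_counit (hρ : Dualizes ρ G.act) :
    IsComoduleHom ρ.toLinearMap (unitCoaction K (H K)) (counitH K).toLinearMap := by
  have hid : Separates fun _ : Unit => AlgHom.id K K := fun a b h => h ()
  refine LinearMap.ext fun a => (hid.tensor separates_evalAt) _ _ fun ⟨_, e⟩ => ?_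
  simp only [LinearMap.comp_apply]
  rw [evalTensor_rTensor (f := evalAt G.one) _ (fun a => by rw [← counitH_eq]; rfl)]
  simp only [AlgHom.toLinearMap_apply, hρ.evalTensor_apply, G.one_act, unitCoaction, counitH_eq]
  simp

theorem isHopfAlgebraInComodules_dot (hδ : Dualizes δ G.dot) (hρ : Dualizes ρ G.act)
    (hΔ : Dualizes Δ G.star) :
    IsHopfAlgebraInComodules Δ (counitH K) δ (counitH K) ρ.toLinearMap := by
  obtain ⟨S, hS⟩ := IsPolynomialOp.exists_algHom_rightInv (isPolynomialOp_dot (K := K))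
  refine ⟨isRightCoaction_act hρ hΔ, isComoduleHom_mul' hρ, isComoduleHom_unit ρ,
    hδ.isBialgebra G.dot_assoc G.one_dot G.dot_one_right, isComoduleHom_dot hδ hρ,
    isComoduleHom_counit hρ, S.toLinearMap, hδ.isAntipode hS G.rightInv_dot G.dot_rightInv,
    LinearMap.ext fun a => separates_evalAt₂ _ _ fun ⟨c, e⟩ => ?_⟩
  simp only [LinearMap.comp_apply]
  rw [evalTensor_rTensor _ (hS c)]
  simp only [AlgHom.toLinearMap_apply, hρ.evalTensor_apply, hS, G.rightInv_act]

end Operations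

end AffineFeedback

theorem mainTheorem6 (K : Type*) [Field K] [CharZero K] :
    (∃! δ : AffineFeedback.H K →ₐ[K] AffineFeedback.H K ⊗[K] AffineFeedback.H K,
      AffineFeedback.Dualizes δ AffineFeedback.G.dot) ∧
    (∃! ρ : AffineFeedback.H K →ₐ[K] AffineFeedback.H K ⊗[K] AffineFeedback.H K,
      AffineFeedback.Dualizes ρ AffineFeedback.G.act) ∧
    (∃! Δ : AffineFeedback.H K →ₐ[K] AffineFeedback.H K ⊗[K] AffineFeedback.H K,
      AffineFeedback.Dualizes Δ AffineFeedback.G.star) ∧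
    ∀ δ ρ Δ : AffineFeedback.H K →ₐ[K] AffineFeedback.H K ⊗[K] AffineFeedback.H K,
      AffineFeedback.Dualizes δ AffineFeedback.G.dot →
      AffineFeedback.Dualizes ρ AffineFeedback.G.act →
      AffineFeedback.Dualizes Δ AffineFeedback.G.star →
        Δ.toLinearMap =
          (LinearMap.mul' K (AffineFeedback.H K)).lTensor (AffineFeedback.H K) ∘ₗ
            (TensorProduct.assoc K (AffineFeedback.H K) (AffineFeedback.H K)
              (AffineFeedback.H K)).toLinearMap ∘ₗ
            ρ.toLinearMap.rTensor (AffineFeedback.H K) ∘ₗ δ.toLinearMap ∧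
        AffineFeedback.IsHopfAlgebra Δ (AffineFeedback.counitH K) ∧
        AffineFeedback.IsHopfAlgebraInComodules Δ (AffineFeedback.counitH K)
          δ (AffineFeedback.counitH K) ρ.toLinearMap := by
  -- Characteristic zero enters only here, to make points separate functions.
  have : Infinite K := CharZero.infinite K
  exact ⟨AffineFeedback.isPolynomialOp_dot.existsUnique_dualizes,
    AffineFeedback.isPolynomialOp_act.existsUnique_dualizes,
    AffineFeedback.isPolynomialOp_star.existsUnique_dualizes,
    fun _ _ _ hδ hρ hΔ => ⟨AffineFeedback.star_eq_comp hδ hρ hΔ,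
      AffineFeedback.isHopfAlgebra_star hΔ,
      AffineFeedback.isHopfAlgebraInComodules_dot hδ hρ hΔ⟩⟩
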